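/- \textbf{Models.} Fix an integer $\kappa\ge 1$. Networks are finite simple undirected $n$-node graphs $G=(V,E)$ whose nodes carry distinct identifiers from $\{1,\dots,n^{\kappa}\}$, chosen by an adversary; every node knows $n$, its own identifier and its own input. A distributed graph problem is a set of triples $(G,x,y)$, where $x$ assigns an input and $y$ an output to every node. A function $f$ is \emph{polylogarithmic}, $f(n)=\log^{O(1)}n$, if $f(n)=O(\log^k n)$ for some constant $k$. \emph{LOCAL.} Computation proceeds in synchronous rounds; in each round every node sends a message of arbitrary size to each neighbour, receives the messages of its neighbours, and performs an arbitrary internal computation. $\mathrm{P\text{-}LOCAL}$ is the class of problems solved by a deterministic LOCAL algorithm in a polylogarithmic number of rounds (on all graphs, inputs and identifier assignments). \emph{SLOCAL.} The nodes are processed one after the other in an arbitrary (adversarial) order. With locality $r(n)$, when a node $v$ is processed, it sees the subgraph induced by its $r(n)$-hop neighbourhood together with the identifiers and inputs of the nodes there and the outputs and local memories of those already processed; as an arbitrary function of this view it computes its own output and the content of its own local memory, of arbitrary size. $\mathrm{P\text{-}SLOCAL}$ is the class of problems solved by a deterministic SLOCAL algorithm with polylogarithmic locality (on all graphs, inputs,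 identifier assignments and orders). A problem $\mathcal P_1$ is \emph{polylog-reducible} to $\mathcal P_2$ if $\mathcal P_2\in\mathrm{P\text{-}LOCAL}$ implies $\mathcal P_1\in\mathrm{P\text{-}LOCAL}$. A problem $\mathcal P$ is \emph{P-SLOCAL-complete} if $\mathcal P\in\mathrm{P\text{-}SLOCAL}$ and every problem in $\mathrm{P\text{-}SLOCAL}$ is polylog-reducible to $\mathcal P$. For real $D$, a \emph{$D$-diameter ordering} of $G$ is an assignment of unique labels (natural numbers) to the nodes such that for every path $P$ of $G$ along which the labels are increasing, any two nodes of $P$ are within distance $D$ in $G$. \textbf{Theorem.} There is a constant $c>0$, independent of $\kappa$, such that for every function $d:\mathbb N\to\mathbb R$ with $d(n)\ge c\ln^2 n$ for all $n\ge 1$ and $d(n)=\log^{O(1)}n$, the problem of computing a $d(n)$-diameter ordering of an $n$-node graph is P-SLOCAL-complete. In particular, every $n$-node graph has an $O(\log^2 n)$-diameter ordering; indeed, every $n$-node graph has a $(c\ln^2 n)$-diameter ordering. -/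

import Mathlib

namespace Distributed

/-! ### Graph problems and identifiers -/

/-- A distributed graph problem: a set of triples `(G, x, y)`, where `G` is a simple undirected graph
on `n` nodes, `x` gives an input and `y` an output to every node. (A promise on the instances `(G, x)`
is expressed by declaring every output valid where the promise fails.) -/
structure Problem where
  In : Type
  Out : Type
  Valid : ∀ n : ℕ, SimpleGraph (Fin n) → (Fin n → In) → (Fin n → Out) → Prop

/-- `f(n) = log^{O(1)} n`. -/
def IsPolylog (f : ℕ → ℝ) : Prop :=
  ∃ k : ℕ, f =O[Filter.atTop] fun n : ℕ => Real.log n ^ k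

/-- Unique identifiers of `O(log n)` bits: an injective map into `{1, …, n ^ κ}`. -/
def IsIdAssignment (κ : ℕ) {n : ℕ} (ident : Fin n → ℕ) : Prop :=
  Function.Injective ident ∧ ∀ v, 1 ≤ ident v ∧ ident v ≤ n ^ κ

/-! ### The LOCAL model -/

/-- A deterministic algorithm in the synchronous message passing model, with unbounded messages and
arbitrary internal computation. Initially, a node knows `n`, its own identifier and its own input.
In one round, a node in state `s` sends `send s j` to its neighbour with identifier `j`, and then
updates its state with `receive`, from the set of all pairs
(identifier of the sender, received message). -/
structure LocalAlg (In Out : Type) where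
  State : Type
  Msg : Type
  init : (n : ℕ) → (ident : ℕ) → In → State
  send : State → ℕ → Msg
  receive : State → Set (ℕ × Msg) → State
  output : State → Out

/-- The states of all nodes after a given number of rounds. -/
def LocalAlg.run {In Out : Type} (A : LocalAlg In Out) {n : ℕ} (G : SimpleGraph (Fin n))
    (ident : Fin n → ℕ) (x : Fin n → In) : ℕ → Fin n → A.State
  | 0 => fun v => A.init n (ident v) (x v)
  | t + 1 => fun v =>
      A.receive (A.run G ident x t v)
        {p | ∃ u, G.Adj v u ∧ p = (ident u, A.send (A.run G ident x t u) (ident v))}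

/-- `LOCAL(t)`: some deterministic algorithm solves the problem in `t(n)` rounds on all `n`-node
graphs, for all inputs and all assignments of identifiers. -/
def InLOCAL (κ : ℕ) (t : ℕ → ℕ) (P : Problem) : Prop :=
  ∃ A : LocalAlg P.In P.Out,
    ∀ (n : ℕ) (G : SimpleGraph (Fin n)) (ident : Fin n → ℕ) (x : Fin n → P.In),
      IsIdAssignment κ ident →
        P.Valid n G x fun v => A.output (A.run G ident x (t n) v)

/-- P-LOCAL: the union of the classes `LOCAL(t)` over all polylogarithmic `t`. -/
def InPLOCAL (κ : ℕ) (P : Problem) : Prop :=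
  ∃ t : ℕ → ℕ, IsPolylog (fun n => (t n : ℝ)) ∧ InLOCAL κ t P

/-! ### The SLOCAL model -/

/-- What a node sees of a neighbourhood: its own identifier, the identifiers and the labels of the
nodes of the neighbourhood, and the edges between these nodes. -/
structure View (L : Type) where
  center : ℕ
  nodes : Set (ℕ × L)
  edges : Set (ℕ × ℕ)

/-- The view of the `r`-hop neighbourhood of `v`. -/
def view {L : Type} {n : ℕ} (G : SimpleGraph (Fin n)) (ident : Fin n → ℕ) (lab : Fin n → L)
    (r : ℕ) (v : Fin n) : View L where
  center := ident v
  nodes := {p | ∃ u, G.edist v u ≤ r ∧ p = (ident u, lab u)}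
  edges := {p | ∃ u w, G.edist v u ≤ r ∧ G.edist v w ≤ r ∧ G.Adj u w ∧ p = (ident u, ident w)}

/-- A deterministic SLOCAL algorithm. When a node is processed, it sees the current states of the
nodes in its neighbourhood, that is, the input of each of them together with its output and its
local memory if it has been processed before (`none` if not), and from this it computes its own
output and the content of its own local memory. -/
structure SlocalAlg (In Out : Type) where
  Mem : Type
  step : (n : ℕ) → View (In × Option (Out × Mem)) → Out × Mem

/-- The states after the nodes of the list `order` have been processed, one after the other, with
locality `r`. -/
def SlocalAlg.run {In Out : Type} (A : SlocalAlg In Out) {n : ℕ} (G : SimpleGraph (Fin n))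
    (ident : Fin n → ℕ) (x : Fin n → In) (r : ℕ) (order : List (Fin n)) :
    Fin n → Option (Out × A.Mem) :=
  order.foldl
    (fun S v => Function.update S v (some (A.step n (view G ident (fun u => (x u, S u)) r v))))
    (fun _ => none)

/-- `SLOCAL(t)`: some deterministic algorithm solves the problem with locality `t(n)` on all `n`-node
graphs, for all inputs, all assignments of identifiers and all orders of processing the nodes. -/
def InSLOCAL (κ : ℕ) (t : ℕ → ℕ) (P : Problem) : Prop :=
  ∃ A : SlocalAlg P.In P.Out,
    ∀ (n : ℕ) (G : SimpleGraph (Fin n)) (ident : Fin n → ℕ) (x : Fin n → P.In)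
      (order : List (Fin n)),
      IsIdAssignment κ ident → order.Nodup → (∀ v, v ∈ order) →
        ∃ y : Fin n → P.Out, P.Valid n G x y ∧
          ∀ v, ∃ m : A.Mem, A.run G ident x (t n) order v = some (y v, m)

/-- P-SLOCAL: the union of the classes `SLOCAL(t)` over all polylogarithmic `t`. -/
def InPSLOCAL (κ : ℕ) (P : Problem) : Prop :=
  ∃ t : ℕ → ℕ, IsPolylog (fun n => (t n : ℝ)) ∧ InSLOCAL κ t P

/-! ### Completeness -/

/-- `P₁` is polylog-reducible to `P₂`: a polylog-time deterministic distributed algorithm for `P₂`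
implies one for `P₁`. -/
def PolylogReducible (κ : ℕ) (P₁ P₂ : Problem) : Prop :=
  InPLOCAL κ P₂ → InPLOCAL κ P₁

/-- P-SLOCAL-completeness. -/
def IsPSLOCALComplete (κ : ℕ) (P : Problem) : Prop :=
  InPSLOCAL κ P ∧ ∀ Q : Problem, InPSLOCAL κ Q → PolylogReducible κ Q P

/-! ### Low diameter orderings -/

/-- `label` is a `D`-diameter ordering of `G`: the labels are unique, and any two nodes of a path
along which the labels increase are within distance `D` in `G`. -/
def IsDiameterOrdering {V : Type*} (G : SimpleGraph V) (D : ℝ) (label : V → ℕ) : Prop :=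
  Function.Injective label ∧
    ∀ (a b : V) (p : G.Walk a b), p.IsPath →
      p.support.Pairwise (fun u v => label u < label v) →
        ∀ u ∈ p.support, ∀ v ∈ p.support, (G.dist u v : ℝ) ≤ D

/-- The problem of computing a `d(n)`-diameter ordering of an `n`-node graph (there is no input). -/
def orderingProblem (d : ℕ → ℝ) : Problem where
  In := Unit
  Out := ℕ
  Valid := fun n G _ y => IsDiameterOrdering G (d n) y

end Distributed

/-! Membership in P-SLOCAL comes from one-pass ball carving with K = ⌊log₂ n⌋ + 1 colours. An
unclustered node weighs two to the number of colours for which it lies on a cluster boundary. An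
unclustered node `v`, when processed, picks a colour `i` for which it is active and a radius `ρ < K`
such that the active mass within `ρ + 1` is at most twice that within `ρ`. The active nodes within
`ρ` form a cluster and those at distance `ρ + 1` its boundary. The boundary weighs at most as much
as the cluster, so doubling its weight while deleting the cluster does not increase the total weight
(`IsCarving.carve`), which stays below 2^K. Hence a free colour always exists
(`IsCarving.exists_active`), and so does a radius (`IsCarving.exists_radius`). Nodes are labelled by
colour, then identifier. An increasing path stays in one cluster while its colour is constant and
changes colour fewer than K times, so its nodes are within 3K² of each other
(`edist_le_of_mem_support`).

For hardness, let `Q` have SLOCAL locality `r`. A LOCAL ordering algorithm is run on the `r`-th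
power of `G`, and its labels serve as the processing order of the SLOCAL algorithm. The state of `v`
depends only on nodes from which an increasing path of the power graph leads to `v`. These lie
within `D` hops in the power, so within `D * r` in `G`, and `v` can replay the relevant part of the
run from its view of radius `D * r + r` (`SlocalAlg.simulate_eq_run`).

The existence of orderings follows by running the carving algorithm on the given graph. -/

namespace Distributed

open SimpleGraph Filter Asymptotics

/-! ### Polylogarithmic functions -/

theorem isBigO_log_pow_of_le {a b : ℕ} (h : a ≤ b) :
    (fun n : ℕ => Real.log n ^ a) =O[atTop] fun n : ℕ => Real.log n ^ b := by
  refine IsBigO.of_bound 1 ?_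
  have h1 : ∀ᶠ n : ℕ in atTop, 1 ≤ Real.log n :=
    (Real.tendsto_log_atTop.comp tendsto_natCast_atTop_atTop).eventually_ge_atTop 1
  filter_upwards [h1] with n hn
  have h0 : 0 ≤ Real.log n := by linarith
  rw [Real.norm_of_nonneg (pow_nonneg h0 _), Real.norm_of_nonneg (pow_nonneg h0 _), one_mul]
  exact pow_le_pow_right₀ hn h

theorem IsPolylog.add {f g : ℕ → ℝ} (hf : IsPolylog f) (hg : IsPolylog g) :
    IsPolylog fun n => f n + g n := by
  obtain ⟨a, ha⟩ := hf
  obtain ⟨b, hb⟩ := hg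
  exact ⟨max a b, (ha.trans (isBigO_log_pow_of_le (le_max_left a b))).add
    (hb.trans (isBigO_log_pow_of_le (le_max_right a b)))⟩

theorem IsPolylog.mul {f g : ℕ → ℝ} (hf : IsPolylog f) (hg : IsPolylog g) :
    IsPolylog fun n => f n * g n := by
  obtain ⟨a, ha⟩ := hf
  obtain ⟨b, hb⟩ := hg
  exact ⟨a + b, (ha.mul hb).congr_right fun n => (pow_add _ _ _).symm⟩

theorem IsPolylog.const (c : ℝ) : IsPolylog fun _ => c := by
  refine ⟨0, ?_⟩
  simpa using isBigO_const_const c (one_ne_zero (α := ℝ)) atTop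

theorem IsPolylog.natFloor {f : ℕ → ℝ} (hf : IsPolylog f) : IsPolylog fun n => (⌊f n⌋₊ : ℝ) := by
  obtain ⟨a, ha⟩ := hf
  refine ⟨a, IsBigO.trans (IsBigO.of_bound 1 (Eventually.of_forall fun n => ?_)) ha⟩
  rw [Real.norm_of_nonneg (Nat.cast_nonneg _), one_mul, Real.norm_eq_abs]
  rcases le_total 0 (f n) with h | h
  · exact (Nat.floor_le h).trans (le_abs_self _)
  · simp [Nat.floor_of_nonpos h]

/-! ### Distances -/

section Distance

variable {V : Type*} {G : SimpleGraph V}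

theorem exists_walk_of_edist_le {u v : V} {k : ℕ} (h : G.edist u v ≤ k) :
    ∃ p : G.Walk u v, p.length ≤ k := by
  obtain ⟨p, hp⟩ := exists_walk_of_edist_ne_top (ne_top_of_le_ne_top (ENat.natCast_ne_top k) h)
  exact ⟨p, by rw [← hp] at h; exact_mod_cast h⟩

theorem edist_le_of_length_le {u v : V} {k : ℕ} (p : G.Walk u v) (h : p.length ≤ k) :
    G.edist u v ≤ k :=
  (edist_le p).trans (by exact_mod_cast h)

theorem edist_le_add {u v w : V} {a b : ℕ} (h : G.edist u v ≤ a) (h' : G.edist v w ≤ b) :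
    G.edist u w ≤ (a + b : ℕ) := by
  rw [Nat.cast_add]
  exact SimpleGraph.edist_triangle.trans (add_le_add h h')

theorem edist_le_mono {u v : V} {a b : ℕ} (h : G.edist u v ≤ a) (hab : a ≤ b) :
    G.edist u v ≤ b :=
  h.trans (by exact_mod_cast hab)

theorem edist_le_one_of_adj {u v : V} (h : G.Adj u v) : G.edist u v ≤ (1 : ℕ) :=
  (edist_eq_one_iff_adj.2 h).le

theorem edist_le_succ_iff {u v : V} {k : ℕ} :
    G.edist u v ≤ (k + 1 : ℕ) ↔ u = v ∨ ∃ w, G.Adj u w ∧ G.edist w v ≤ k := by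
  constructor
  · intro h
    obtain ⟨p, hp⟩ := exists_walk_of_edist_le h
    cases p with
    | nil => exact Or.inl rfl
    | cons hadj q =>
      rw [Walk.length_cons] at hp
      exact Or.inr ⟨_, hadj, edist_le_of_length_le q (by omega)⟩
  · rintro (rfl | ⟨w, hw, h⟩)
    · simp
    · exact edist_le_mono (edist_le_add (edist_le_one_of_adj hw) h) (by omega)

theorem dist_le_of_edist_le {u v : V} {k : ℕ} (h : G.edist u v ≤ k) : G.dist u v ≤ k :=
  ENat.toNat_le_of_le_natCast h

end Distance

/-! ### Views -/

/-- Reachability in at most `k` steps along the pairs of `E`. -/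
def Within (E : Set (ℕ × ℕ)) : ℕ → ℕ → ℕ → Prop
  | 0 => fun a b => a = b
  | k + 1 => fun a b => a = b ∨ ∃ c, (a, c) ∈ E ∧ Within E k c b

/-- The part of a view within distance `r` of the node with identifier `c`. -/
def View.sub {L : Type} (V : View L) (c r : ℕ) : View L where
  center := c
  nodes := {p | p ∈ V.nodes ∧ Within V.edges r c p.1}
  edges := {e | e ∈ V.edges ∧ Within V.edges r c e.1 ∧ Within V.edges r c e.2}

/-- Replace the label `l` of every node with identifier `j` by `f j l`. -/
def View.relabel {L L' : Type} (V : View L) (f : ℕ → L → L') : View L' where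
  center := V.center
  nodes := {p | ∃ q ∈ V.nodes, p = (q.1, f q.1 q.2)}
  edges := V.edges

section View

variable {L L' : Type} {n : ℕ} {G : SimpleGraph (Fin n)} {ident : Fin n → ℕ}

/-- The condition `a + k ≤ R` keeps every walk of `k` steps from `u` inside the view, so no edge it
needs is cut off. -/
theorem within_view_iff (hid : Function.Injective ident) {lab : Fin n → L} {R : ℕ} {v : Fin n}
    {a k : ℕ} (hk : a + k ≤ R) {u : Fin n} (hu : G.edist v u ≤ a) {j : ℕ} :
    Within (view G ident lab R v).edges k (ident u) j ↔ ∃ w, G.edist u w ≤ k ∧ j = ident w := by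
  induction k generalizing a u with
  | zero =>
    simp only [Within, Nat.cast_zero, nonpos_iff_eq_zero, edist_eq_zero_iff]
    exact ⟨fun h => ⟨u, rfl, h.symm⟩, by rintro ⟨w, rfl, rfl⟩; rfl⟩
  | succ k ih =>
    constructor
    · rintro (rfl | ⟨c, ⟨u', w, -, hw, hadj, he⟩, hc⟩)
      · exact ⟨u, by simp, rfl⟩
      · obtain ⟨h1, rfl⟩ := Prod.mk.inj he
        obtain rfl := hid h1
        obtain ⟨z, hz, rfl⟩ := (ih (a := a + 1) (by omega)
          (edist_le_add hu (edist_le_one_of_adj hadj))).1 hc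
        exact ⟨z, edist_le_succ_iff.2 (Or.inr ⟨w, hadj, hz⟩), rfl⟩
    · rintro ⟨z, hz, rfl⟩
      rcases edist_le_succ_iff.1 hz with rfl | ⟨w, hadj, hw⟩
      · exact Or.inl rfl
      · have hvw := edist_le_add hu (edist_le_one_of_adj hadj)
        exact Or.inr ⟨ident w, ⟨u, w, edist_le_mono hu (by omega), edist_le_mono hvw (by omega),
          hadj, rfl⟩, (ih (a := a + 1) (by omega) hvw).2 ⟨z, hw, rfl⟩⟩

theorem within_view_ident_iff (hid : Function.Injective ident) {lab : Fin n → L} {R : ℕ}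
    {v : Fin n} {a k : ℕ} (hk : a + k ≤ R) {u : Fin n} (hu : G.edist v u ≤ a) {w : Fin n} :
    Within (view G ident lab R v).edges k (ident u) (ident w) ↔ G.edist u w ≤ k := by
  rw [within_view_iff hid hk hu]
  exact ⟨by rintro ⟨w', h, h'⟩; rwa [hid h'], fun h => ⟨w, h, rfl⟩⟩

/-- A large view determines the smaller views of the nodes well inside it. Both the composition of
local maps and the replay of an SLOCAL run rest on this. -/
theorem sub_view (hid : Function.Injective ident) {lab : Fin n → L} {R : ℕ} {v : Fin n}
    {a r : ℕ} (hr : a + r ≤ R) {u : Fin n} (hu : G.edist v u ≤ a) :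
    (view G ident lab R v).sub (ident u) r = view G ident lab r u := by
  have hR : ∀ w, G.edist u w ≤ r → G.edist v w ≤ R := fun w hw =>
    edist_le_mono (edist_le_add hu hw) hr
  simp only [View.sub, view, View.mk.injEq, true_and]
  constructor
  · ext p
    constructor
    · rintro ⟨⟨w, -, rfl⟩, h⟩
      exact ⟨w, (within_view_ident_iff hid (lab := lab) hr hu).1 h, rfl⟩
    · rintro ⟨w, hw, rfl⟩
      exact ⟨⟨w, hR w hw, rfl⟩, (within_view_ident_iff hid (lab := lab) hr hu).2 hw⟩
  · ext e
    constructor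
    · rintro ⟨⟨w, z, -, -, hadj, rfl⟩, h1, h2⟩
      exact ⟨w, z, (within_view_ident_iff hid (lab := lab) hr hu).1 h1,
        (within_view_ident_iff hid (lab := lab) hr hu).1 h2, hadj, rfl⟩
    · rintro ⟨w, z, hw, hz, hadj, rfl⟩
      exact ⟨⟨w, z, hR w hw, hR z hz, hadj, rfl⟩,
        (within_view_ident_iff hid (lab := lab) hr hu).2 hw,
        (within_view_ident_iff hid (lab := lab) hr hu).2 hz⟩

theorem relabel_view (f : ℕ → L → L') (lab : Fin n → L) (r : ℕ) (v : Fin n) :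
    (view G ident lab r v).relabel f = view G ident (fun u => f (ident u) (lab u)) r v := by
  simp only [View.relabel, view, View.mk.injEq, true_and, and_true]
  ext p
  constructor
  · rintro ⟨_, ⟨u, hu, rfl⟩, rfl⟩
    exact ⟨u, hu, rfl⟩
  · rintro ⟨u, hu, rfl⟩
    exact ⟨_, ⟨u, hu, rfl⟩, rfl⟩

theorem view_congr {lab lab' : Fin n → L} {r : ℕ} {v : Fin n}
    (h : ∀ u, G.edist v u ≤ r → lab u = lab' u) :
    view G ident lab r v = view G ident lab' r v := by
  simp only [view, View.mk.injEq, true_and, and_true]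
  ext p
  constructor
  · rintro ⟨u, hu, rfl⟩
    exact ⟨u, hu, by rw [h u hu]⟩
  · rintro ⟨u, hu, rfl⟩
    exact ⟨u, hu, by rw [h u hu]⟩

end View

/-! ### Local functions -/

/-- `F` computes the new label of a node from its old label and its view of radius `R`. -/
def IsLocalMap {n : ℕ} {L L' : Type} (R : ℕ)
    (F : SimpleGraph (Fin n) → (Fin n → ℕ) → (Fin n → L) → Fin n → L') : Prop :=
  ∃ f : L → View L → L', ∀ G ident x v, Function.Injective ident →
    F G ident x v = f (x v) (view G ident x R v)

/-- A view of radius `R₁ + R₂` contains the `R₁`-views of all nodes within `R₂`, so their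
intermediate labels can be recomputed from it. -/
theorem IsLocalMap.comp {n : ℕ} {L₁ L₂ L₃ : Type} {R₁ R₂ : ℕ}
    {F₁ : SimpleGraph (Fin n) → (Fin n → ℕ) → (Fin n → L₁) → Fin n → L₂}
    {F₂ : SimpleGraph (Fin n) → (Fin n → ℕ) → (Fin n → L₂) → Fin n → L₃}
    (h₂ : IsLocalMap R₂ F₂) (h₁ : IsLocalMap R₁ F₁) :
    IsLocalMap (R₁ + R₂) fun G ident x => F₂ G ident (F₁ G ident x) := by
  obtain ⟨f₁, h₁⟩ := h₁
  obtain ⟨f₂, h₂⟩ := h₂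
  refine ⟨fun l V => f₂ (f₁ l (V.sub V.center R₁))
    ((V.sub V.center R₂).relabel fun j l' => f₁ l' (V.sub j R₁)), fun G ident x v hid => ?_⟩
  have hv : G.edist v v ≤ (0 : ℕ) := by simp
  have e₁ : (view G ident x (R₁ + R₂) v).sub (ident v) R₁ = view G ident x R₁ v :=
    sub_view hid (by omega) hv
  have e₂ : (view G ident x (R₁ + R₂) v).sub (ident v) R₂ = view G ident x R₂ v :=
    sub_view hid (by omega) hv
  have hc : (view G ident x (R₁ + R₂) v).center = ident v := rfl
  beta_reduce
  rw [h₂ _ _ _ _ hid, hc, e₁, e₂, relabel_view, ← h₁ _ _ _ _ hid]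
  congr 1
  refine view_congr fun u hu => ?_
  rw [sub_view hid (by omega) hu, h₁ _ _ _ _ hid]

/-! ### Gathering views in the LOCAL model -/

/-- The knowledge of a node that gathers its neighbourhood: `nodes k` and `edges k` hold the nodes
within distance `k` and the edges with an endpoint within distance `k`. -/
structure GatherState (L : Type) where
  size : ℕ
  ident : ℕ
  label : L
  nodes : ℕ → Set (ℕ × L)
  edges : ℕ → Set (ℕ × ℕ)

/-- The algorithm which gathers the view of radius `R n` and applies `f n` to it. -/
def gatherAlg {L L' : Type} (R : ℕ → ℕ) (f : ℕ → L → View L → L') : LocalAlg L L' where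
  State := GatherState L
  Msg := GatherState L
  init n i l := ⟨n, i, l, fun _ => {(i, l)}, fun _ => ∅⟩
  send s _ := s
  receive s M := ⟨s.size, s.ident, s.label,
    fun k => {p | p = (s.ident, s.label) ∨ ∃ k', k = k' + 1 ∧ ∃ m ∈ M, p ∈ m.2.nodes k'},
    fun k => {e | (∃ m ∈ M, e = (s.ident, m.1)) ∨ ∃ k', k = k' + 1 ∧ ∃ m ∈ M, e ∈ m.2.edges k'}⟩
  output s := f s.size s.label ⟨s.ident, s.nodes (R s.size),
    {e | e ∈ s.edges (R s.size) ∧ (∃ l, (e.1, l) ∈ s.nodes (R s.size)) ∧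
      ∃ l, (e.2, l) ∈ s.nodes (R s.size)}⟩

section Gather

variable {L L' : Type} (R : ℕ → ℕ) (f : ℕ → L → View L → L') {n : ℕ} (G : SimpleGraph (Fin n))
  (ident : Fin n → ℕ) (x : Fin n → L)

theorem gatherAlg_run_const (t : ℕ) (v : Fin n) :
    ((gatherAlg R f).run G ident x t v).size = n ∧
      ((gatherAlg R f).run G ident x t v).ident = ident v ∧
        ((gatherAlg R f).run G ident x t v).label = x v := by
  induction t with
  | zero => exact ⟨rfl, rfl, rfl⟩
  | succ t ih => exact ih

/-- Level `k` is rebuilt in each round from the neighbours' level `k - 1`, so it is exact from round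
`k` on and further rounds do not enlarge it. -/
theorem gatherAlg_run_nodes {t k : ℕ} (hk : k ≤ t) (v : Fin n) :
    ((gatherAlg R f).run G ident x t v).nodes k =
      {p | ∃ u, G.edist v u ≤ k ∧ p = (ident u, x u)} := by
  induction t generalizing k v with
  | zero =>
    obtain rfl : k = 0 := by omega
    ext p
    simp [LocalAlg.run, gatherAlg]
  | succ t ih =>
    obtain ⟨-, h2, h3⟩ := gatherAlg_run_const R f G ident x t v
    ext p
    change (p = (((gatherAlg R f).run G ident x t v).ident,
      ((gatherAlg R f).run G ident x t v).label) ∨ ∃ k', k = k' + 1 ∧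
        ∃ m ∈ {p | ∃ u, G.Adj v u ∧ p = (ident u, (gatherAlg R f).run G ident x t u)},
          p ∈ m.2.nodes k') ↔ _
    rw [h2, h3]
    constructor
    · rintro (rfl | ⟨k', rfl, _, ⟨u, hu, rfl⟩, hp⟩)
      · exact ⟨v, by simp, rfl⟩
      · rw [ih (by omega)] at hp
        obtain ⟨w, hw, rfl⟩ := hp
        exact ⟨w, edist_le_succ_iff.2 (Or.inr ⟨u, hu, hw⟩), rfl⟩
    · rintro ⟨w, hw, rfl⟩
      cases k with
      | zero =>
        obtain rfl : v = w := by simpa using hw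
        exact Or.inl rfl
      | succ k =>
        rcases edist_le_succ_iff.1 hw with rfl | ⟨u, hu, hw⟩
        · exact Or.inl rfl
        · refine Or.inr ⟨k, rfl, _, ⟨u, hu, rfl⟩, ?_⟩
          rw [ih (by omega)]
          exact ⟨w, hw, rfl⟩

/-- The inequality is strict because a node learns its incident edges only from the first messages.
This costs the extra round in `gatherAlg_output`. -/
theorem gatherAlg_run_edges {t k : ℕ} (hk : k < t) (v : Fin n) :
    ((gatherAlg R f).run G ident x t v).edges k =
      {e | ∃ u w, G.edist v u ≤ k ∧ G.Adj u w ∧ e = (ident u, ident w)} := by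
  induction t generalizing k v with
  | zero => omega
  | succ t ih =>
    obtain ⟨-, h2, -⟩ := gatherAlg_run_const R f G ident x t v
    ext e
    change ((∃ m ∈ {p | ∃ u, G.Adj v u ∧ p = (ident u, (gatherAlg R f).run G ident x t u)},
      e = (((gatherAlg R f).run G ident x t v).ident, m.1)) ∨ ∃ k', k = k' + 1 ∧
        ∃ m ∈ {p | ∃ u, G.Adj v u ∧ p = (ident u, (gatherAlg R f).run G ident x t u)},
          e ∈ m.2.edges k') ↔ _
    rw [h2]
    constructor
    · rintro (⟨_, ⟨u, hu, rfl⟩, rfl⟩ | ⟨k', rfl, _, ⟨u, hu, rfl⟩, hp⟩)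
      · exact ⟨v, u, by simp, hu, rfl⟩
      · rw [ih (by omega)] at hp
        obtain ⟨w, z, hw, hz, rfl⟩ := hp
        exact ⟨w, z, edist_le_succ_iff.2 (Or.inr ⟨u, hu, hw⟩), hz, rfl⟩
    · rintro ⟨w, z, hw, hz, rfl⟩
      cases k with
      | zero =>
        obtain rfl : v = w := by simpa using hw
        exact Or.inl ⟨_, ⟨z, hz, rfl⟩, rfl⟩
      | succ k =>
        rcases edist_le_succ_iff.1 hw with rfl | ⟨u, hu, hw⟩
        · exact Or.inl ⟨_, ⟨z, hz, rfl⟩, rfl⟩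
        · refine Or.inr ⟨k, rfl, _, ⟨u, hu, rfl⟩, ?_⟩
          rw [ih (by omega)]
          exact ⟨w, z, hw, hz, rfl⟩

theorem gatherAlg_output (hid : Function.Injective ident) (v : Fin n) :
    (gatherAlg R f).output ((gatherAlg R f).run G ident x (R n + 1) v) =
      f n (x v) (view G ident x (R n) v) := by
  obtain ⟨h1, h2, h3⟩ := gatherAlg_run_const R f G ident x (R n + 1) v
  change f _ _ _ = _
  rw [h1, h2, h3, gatherAlg_run_nodes R f G ident x (by omega),
    gatherAlg_run_edges R f G ident x (by omega)]
  congr 1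
  simp only [view, View.mk.injEq, true_and]
  ext e
  constructor
  · rintro ⟨⟨u, w, hu, huw, rfl⟩, -, l, z, hz, hl⟩
    obtain rfl := hid (Prod.mk.inj hl).1
    exact ⟨u, w, hu, hz, huw, rfl⟩
  · rintro ⟨u, w, hu, hw, huw, rfl⟩
    exact ⟨⟨u, w, hu, huw, rfl⟩, ⟨x u, u, hu, rfl⟩, ⟨x w, w, hw, rfl⟩⟩

end Gather

/-- A problem is in LOCAL if for every `n` some local map solves it. -/
theorem inLOCAL_of_isLocalMap {κ : ℕ} {R : ℕ → ℕ} {P : Problem}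
    (h : ∀ n : ℕ, ∃ F : SimpleGraph (Fin n) → (Fin n → ℕ) → (Fin n → P.In) → Fin n → P.Out,
      IsLocalMap (R n) F ∧ ∀ G ident x, IsIdAssignment κ ident →
        P.Valid n G x (F G ident x)) :
    InLOCAL κ (fun n => R n + 1) P := by
  choose F hF hval using h
  choose f hf using hF
  refine ⟨gatherAlg R f, fun n G ident x hid => ?_⟩
  convert hval n G ident x hid using 1
  ext v
  rw [gatherAlg_output R f G ident x hid.1, hf n G ident x v hid.1]

/-! ### Algorithms on the power of a graph -/

/-- Two nodes are adjacent in the `r`-th power of `G` if their distance is at most `r`. -/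
def power {V : Type*} (G : SimpleGraph V) (r : ℕ) : SimpleGraph V where
  Adj u v := u ≠ v ∧ G.edist u v ≤ r
  symm := ⟨fun u v h => ⟨h.1.symm, by rw [SimpleGraph.edist_comm]; exact h.2⟩⟩
  loopless := ⟨fun _ h => h.1 rfl⟩

theorem edist_le_of_walk_power {V : Type*} {G : SimpleGraph V} {r : ℕ} {u v : V}
    (p : (power G r).Walk u v) : G.edist u v ≤ (p.length * r : ℕ) := by
  induction p with
  | nil => simp
  | cons h p ih =>
    refine edist_le_mono (edist_le_add h.2 ih) (le_of_eq ?_)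
    rw [Walk.length_cons]
    ring

/-- One round on the power graph reads only states within distance `r` in `G`, so it is a local map
of radius `r`, and `t` rounds compose. -/
theorem isLocalMap_run_power {In Out : Type} (A : LocalAlg In Out) (n r t : ℕ) :
    IsLocalMap (t * r) fun (G : SimpleGraph (Fin n)) ident x => A.run (power G r) ident x t := by
  induction t with
  | zero => exact ⟨fun l V => A.init n V.center l, fun _ _ _ _ _ => rfl⟩
  | succ t ih =>
    have hround : IsLocalMap r fun (G : SimpleGraph (Fin n)) ident (s : Fin n → A.State) v =>
        A.receive (s v)
          {p | ∃ u, (power G r).Adj v u ∧ p = (ident u, A.send (s u) (ident v))} := by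
      refine ⟨fun l V => A.receive l
        {p | ∃ q ∈ V.nodes, q.1 ≠ V.center ∧ p = (q.1, A.send q.2 V.center)},
        fun G ident s v hid => ?_⟩
      refine congrArg (A.receive (s v)) (Set.ext fun p => ?_)
      constructor
      · rintro ⟨u, ⟨hne, hu⟩, rfl⟩
        exact ⟨_, ⟨u, hu, rfl⟩, fun h => hne (hid h).symm, rfl⟩
      · rintro ⟨_, ⟨u, hu, rfl⟩, hne, rfl⟩
        exact ⟨u, ⟨fun h => hne (congrArg ident h.symm), hu⟩, rfl⟩
    rw [Nat.succ_mul]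
    exact hround.comp ih

/-- The input is kept next to the computed rank because the later simulation reads both. -/
theorem isLocalMap_output_power {In Out : Type} (A : LocalAlg Unit Out) (n r t : ℕ) :
    IsLocalMap (t * r) fun (G : SimpleGraph (Fin n)) ident (x : Fin n → In) v =>
      (x v, A.output (A.run (power G r) ident (fun _ => ()) t v)) := by
  obtain ⟨f, hf⟩ := isLocalMap_run_power A n r t
  refine ⟨fun l V => (l, A.output (f () (V.relabel fun _ _ => ()))), fun G ident x v hid => ?_⟩
  have h := hf G ident (fun _ => ()) v hid
  beta_reduce at h ⊢
  rw [h, relabel_view]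

/-! ### Simulating an SLOCAL algorithm along an ordering -/

/-- The result of the step of the node with identifier `j` and rank `ℓ`, computed from a view in
which every node is labelled with its input and its rank. -/
noncomputable def SlocalAlg.simulate {In Out : Type} (B : SlocalAlg In Out) (n r : ℕ) (V : View (In × ℕ)) (j ℓ : ℕ) : Out × B.Mem :=
  B.step n ((V.sub j r).relabel fun j' q =>
    (q.1, if _h : q.2 < ℓ then some (B.simulate n r V j' q.2) else none))
termination_by ℓ

section Simulation

variable {In Out : Type} (B : SlocalAlg In Out) {n : ℕ}

theorem SlocalAlg.run_concat (G : SimpleGraph (Fin n)) (ident : Fin n → ℕ) (x : Fin n → In)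
    (r : ℕ) (l : List (Fin n)) (w : Fin n) :
    B.run G ident x r (l ++ [w]) = Function.update (B.run G ident x r l) w
      (some (B.step n (view G ident (fun u => (x u, B.run G ident x r l u)) r w))) := by
  simp [SlocalAlg.run, List.foldl_append]

/-- Each node is processed once, so its state at that moment is already final. The final states
therefore satisfy a recursion along the ranks that no longer mentions time. -/
theorem SlocalAlg.run_of_sorted (G : SimpleGraph (Fin n)) (ident : Fin n → ℕ) (x : Fin n → In)
    (r : ℕ) (y : Fin n → ℕ) (l : List (Fin n)) (hl : l.Pairwise fun u v => y u < y v) :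
    (∀ v, v ∉ l → B.run G ident x r l v = none) ∧
      ∀ v ∈ l, B.run G ident x r l v = some (B.step n (view G ident
        (fun u => (x u, if y u < y v then B.run G ident x r l u else none)) r v)) := by
  induction l using List.reverseRecOn with
  | nil => exact ⟨fun v _ => rfl, by simp⟩
  | append_singleton l w ih =>
    obtain ⟨hl', -, hlw⟩ := List.pairwise_append.1 hl
    obtain ⟨ih1, ih2⟩ := ih hl'
    have hlw : ∀ u ∈ l, y u < y w := fun u hu => hlw u hu w (by simp)
    have hne : ∀ u, u ≠ w → B.run G ident x r (l ++ [w]) u = B.run G ident x r l u :=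
      fun u hu => by rw [B.run_concat, Function.update_of_ne hu]
    refine ⟨fun v hv => ?_, fun v hv => ?_⟩
    · rw [hne v (by rintro rfl; simp at hv), ih1 v (by simp at hv; exact hv.1)]
    · by_cases hvw : v = w
      · subst hvw
        nth_rewrite 1 [B.run_concat]
        rw [Function.update_self]
        congr 2
        refine view_congr fun u _ => ?_
        congr 1
        by_cases hu : u ∈ l
        · rw [if_pos (hlw u hu), hne u (by rintro rfl; exact (hlw u hu).ne rfl)]
        · rw [ih1 u hu]
          split_ifs with h
          · rw [hne u (by rintro rfl; exact h.ne rfl), ih1 u hu]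
          · rfl
      · have hv : v ∈ l := by simpa [hvw] using hv
        rw [hne v hvw, ih2 v hv]
        congr 2
        refine view_congr fun u _ => ?_
        congr 1
        split_ifs with h
        · rw [hne u fun e => (hlw v hv).not_gt (e ▸ h)]
        · rfl

/-- The recursion of `simulate` descends along increasing walks of the power graph that end at `v`.
By `hD` it never leaves distance `D * r` from `v`, where views of radius `r` are still available. -/
theorem SlocalAlg.simulate_eq_run {G : SimpleGraph (Fin n)} {ident : Fin n → ℕ}
    (hid : Function.Injective ident) (x : Fin n → In) {r D : ℕ} {y : Fin n → ℕ}
    {l : List (Fin n)} (hl : l.Pairwise fun u v => y u < y v) (hmem : ∀ v, v ∈ l)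
    (hD : ∀ (w v : Fin n) (p : (power G r).Walk w v),
      p.support.Pairwise (fun a b => y a < y b) → (power G r).dist w v ≤ D) (v : Fin n) :
    B.run G ident x r l v = some (B.simulate n r
      (view G ident (fun u => (x u, y u)) (D * r + r) v) (ident v) (y v)) := by
  -- The claim is strengthened to every start `w` of an increasing walk to `v`, for induction on the
  -- rank of `w`.
  suffices h : ∀ m w, y w = m → ∀ p : (power G r).Walk w v,
      p.support.Pairwise (fun a b => y a < y b) →
      B.run G ident x r l w = some (B.simulate n r
        (view G ident (fun u => (x u, y u)) (D * r + r) v) (ident w) (y w)) from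
    h _ v rfl Walk.nil (by simp)
  intro m
  induction m using Nat.strong_induction_on with
  | _ m ih =>
    rintro w rfl p hp
    have hvw : G.edist v w ≤ (D * r : ℕ) := by
      -- Reachability is needed because `dist` is `0` between unreachable nodes.
      obtain ⟨q, hq⟩ := p.reachable.exists_walk_length_eq_dist
      rw [SimpleGraph.edist_comm]
      exact edist_le_mono (edist_le_of_walk_power q)
        (Nat.mul_le_mul_right r (hq ▸ hD w v p hp))
    rw [SlocalAlg.simulate, sub_view hid le_rfl hvw, relabel_view,
      (B.run_of_sorted G ident x r y l hl).2 w (hmem w)]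
    congr 2
    refine view_congr fun u hu => ?_
    by_cases h : y u < y w
    · have hadj : (power G r).Adj u w :=
        ⟨by rintro rfl; exact h.ne rfl, by rw [SimpleGraph.edist_comm]; exact hu⟩
      have hpw : (Walk.cons hadj p).support.Pairwise fun a b => y a < y b := by
        rw [Walk.support_cons, List.pairwise_cons]
        refine ⟨fun z hz => ?_, hp⟩
        rw [← Walk.cons_tail_support] at hz hp
        rcases List.mem_cons.1 hz with rfl | hz
        · exact h
        · exact h.trans ((List.pairwise_cons.1 hp).1 z hz)
      simp only [if_pos h, dif_pos h, ih _ h u rfl _ hpw]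
    · simp only [if_neg h, dif_neg h]

end Simulation

theorem exists_sorted_list {n : ℕ} {y : Fin n → ℕ} (hy : Function.Injective y) :
    ∃ l : List (Fin n), l.Nodup ∧ (∀ v, v ∈ l) ∧ l.Pairwise fun u v => y u < y v := by
  let le : Fin n → Fin n → Prop := fun u v => y u ≤ y v
  have : Std.Total le := ⟨fun u v => le_total (y u) (y v)⟩
  have : IsTrans (Fin n) le := ⟨fun _ _ _ => le_trans (α := ℕ)⟩
  have hperm := List.perm_insertionSort le (List.finRange n)
  have hnd : (List.insertionSort le (List.finRange n)).Nodup :=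
    hperm.nodup_iff.2 (List.nodup_finRange n)
  refine ⟨_, hnd, fun v => hperm.mem_iff.2 (List.mem_finRange v), ?_⟩
  refine ((List.pairwise_insertionSort le (List.finRange n)).and hnd).imp fun h => ?_
  exact lt_of_le_of_ne h.1 fun h' => h.2 (hy h')

/-- Every problem in P-SLOCAL reduces to computing a diameter ordering. -/
theorem polylogReducible_orderingProblem {κ : ℕ} {d : ℕ → ℝ} (hd : IsPolylog d) {Q : Problem}
    (hQ : InPSLOCAL κ Q) : PolylogReducible κ Q (orderingProblem d) := by
  rintro ⟨t, ht, A, hA⟩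
  obtain ⟨r, hr, B, hB⟩ := hQ
  change LocalAlg Unit ℕ at A
  refine ⟨fun n => t n * r n + (⌊d n⌋₊ * r n + r n) + 1, ?_, inLOCAL_of_isLocalMap
    (R := fun n => t n * r n + (⌊d n⌋₊ * r n + r n)) fun n => ?_⟩
  · have := ((ht.mul hr).add ((hd.natFloor.mul hr).add hr)).add (IsPolylog.const 1)
    exact_mod_cast this
  let F₂ : SimpleGraph (Fin n) → (Fin n → ℕ) → (Fin n → Q.In × ℕ) → Fin n → Q.Out :=
    fun G ident z v => (B.simulate n (r n) (view G ident z (⌊d n⌋₊ * r n + r n) v)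
      (ident v) (z v).2).1
  have hF₂ : IsLocalMap (⌊d n⌋₊ * r n + r n) F₂ :=
    ⟨fun l V => (B.simulate n (r n) V V.center l.2).1, fun _ _ _ _ _ => rfl⟩
  refine ⟨_, hF₂.comp (isLocalMap_output_power A n (r n) (t n)), fun G ident x hid => ?_⟩
  -- The power graph has the same number of nodes and the same identifiers, so the bound is still `d
  -- n`.
  obtain ⟨hinj, hdiam⟩ := hA n (power G (r n)) ident (fun _ => ()) hid
  obtain ⟨l, hnd, hmem, hl⟩ := exists_sorted_list hinj
  obtain ⟨out, hval, hout⟩ := hB n G ident x l hid hnd hmem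
  convert hval using 1
  ext v
  obtain ⟨m, hm⟩ := hout v
  have hD : ∀ (w v : Fin n) (p : (power G (r n)).Walk w v), p.support.Pairwise (fun a b =>
      A.output (A.run (power G (r n)) ident (fun _ => ()) (t n) a) <
        A.output (A.run (power G (r n)) ident (fun _ => ()) (t n) b)) →
      (power G (r n)).dist w v ≤ ⌊d n⌋₊ := fun w v p hp => by
    refine Nat.le_floor (hdiam w v p ?_ hp w p.start_mem_support v p.end_mem_support)
    rw [Walk.isPath_def]
    exact hp.imp fun h h' => by subst h'; exact lt_irrefl _ h
  have key := B.simulate_eq_run hid.1 x hl hmem hD v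
  rw [hm, Option.some.injEq] at key
  exact (congrArg Prod.fst key).symm

/-! ### Weighted ball carving -/

section Carving

open scoped Classical

variable {V : Type*} {G : SimpleGraph V} {K : ℕ} {g b : V → ℕ → V → Prop}

/-- A node is active for the colour `i` if it is in no cluster and not on the boundary of a cluster
of colour `i`. -/
def Active (g b : V → ℕ → V → Prop) (i : ℕ) (w : V) : Prop :=
  (∀ j u, ¬ g w j u) ∧ ∀ u, ¬ b w i u

/-- Two to the number of colours for which a node is on the boundary of a cluster. -/
noncomputable def weight (K : ℕ) (b : V → ℕ → V → Prop) (w : V) : ℕ :=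
  2 ^ ((Finset.range K).filter fun i => ∃ u, b w i u).card

/-- The weight of the active nodes within distance `ρ` of `v`. -/
noncomputable def mass [Fintype V] (G : SimpleGraph V) (K : ℕ) (g b : V → ℕ → V → Prop) (i : ℕ)
    (v : V) (ρ : ℕ) : ℕ :=
  ∑ w, if G.edist v w ≤ ρ ∧ Active g b i w then weight K b w else 0

/-- The weight of the nodes in no cluster. -/
noncomputable def potential [Fintype V] (K : ℕ) (g b : V → ℕ → V → Prop) : ℕ :=
  ∑ w, if ∃ i u, g w i u then 0 else weight K b w

/-- A partial clustering: `g w i u` says that `w` is in the cluster of colour `i` with centre `u`, and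
`b w i u` says that `w` is on the boundary of this cluster. -/
structure IsCarving [Fintype V] (G : SimpleGraph V) (K : ℕ) (g b : V → ℕ → V → Prop) : Prop where
  good_near : ∀ {w i u}, g w i u → i < K ∧ G.edist u w ≤ K
  bad_near : ∀ {w i u}, b w i u → i < K ∧ G.edist u w ≤ K
  good_unique : ∀ {w i u i' u'}, g w i u → g w i' u' → i = i' ∧ u = u'
  -- No node active for colour `i` is adjacent to a cluster of colour `i`. This is what preserves
  -- `separated` in later carvings.
  closed : ∀ {w i u w'}, g w i u → G.Adj w w' → (∃ i' u', g w' i' u') ∨ ∃ u', b w' i u'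
  separated : ∀ {w i u w' u'}, g w i u → g w' i u' → G.Adj w w' → u = u'
  potential_lt : potential K g b < 2 ^ K

theorem weight_eq_two_pow {w : V} (h : ∀ i < K, ∃ u, b w i u) : weight K b w = 2 ^ K := by
  rw [weight, Finset.filter_true_of_mem fun i hi => h i (Finset.mem_range.1 hi),
    Finset.card_range]

theorem weight_congr {b' : V → ℕ → V → Prop} {w : V} (h : ∀ i u, b w i u ↔ b' w i u) :
    weight K b w = weight K b' w := by
  simp only [weight, h]

theorem isCarving_empty [Fintype V] (hK : Fintype.card V < 2 ^ K) :
    IsCarving G K (fun _ _ _ => False) fun _ _ _ => False where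
  good_near h := h.elim
  bad_near h := h.elim
  good_unique h := h.elim
  closed h := h.elim
  separated h := h.elim
  potential_lt := by simpa [potential, weight] using hK

theorem IsCarving.weight_lt [Fintype V] (h : IsCarving G K g b) {v : V} (hv : ∀ j u, ¬ g v j u) :
    weight K b v < 2 ^ K := by
  refine lt_of_le_of_lt ?_ h.potential_lt
  have := Finset.single_le_sum (f := fun w => if ∃ i u, g w i u then 0 else weight K b w)
    (fun _ _ => Nat.zero_le _) (Finset.mem_univ v)
  simpa [hv, potential] using this

/-- If all `K` colours were blocked at `v`, its weight alone would be 2^K, exceeding the potential.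
-/
theorem IsCarving.exists_active [Fintype V] (h : IsCarving G K g b) {v : V}
    (hv : ∀ j u, ¬ g v j u) : ∃ i < K, ∀ u, ¬ b v i u := by
  by_contra! hcon
  have hlt := h.weight_lt hv
  rw [weight_eq_two_pow hcon] at hlt
  exact lt_irrefl _ hlt

theorem mass_le_potential [Fintype V] (i : ℕ) (v : V) (ρ : ℕ) :
    mass G K g b i v ρ ≤ potential K g b := by
  refine Finset.sum_le_sum fun w _ => ?_
  split_ifs with h1 h2
  · obtain ⟨j, u, hu⟩ := h2
    exact absurd hu (h1.2.1 j u)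
  all_goals simp

/-- Otherwise the mass, at least 1 at radius 0, would more than double `K` times and reach 2^K,
exceeding the potential. -/
theorem IsCarving.exists_radius [Fintype V] (h : IsCarving G K g b) {v : V} {i : ℕ}
    (hv : Active g b i v) :
    ∃ ρ < K, mass G K g b i v (ρ + 1) ≤ 2 * mass G K g b i v ρ := by
  by_contra! hcon
  have hgrow : ∀ ρ ≤ K, 2 ^ ρ ≤ mass G K g b i v ρ := by
    intro ρ hρ
    induction ρ with
    | zero =>
      have h1 := Finset.single_le_sum
        (f := fun w => if G.edist v w ≤ (0 : ℕ) ∧ Active g b i w then weight K b w else 0)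
        (fun _ _ => Nat.zero_le _) (Finset.mem_univ v)
      have h2 : 1 ≤ weight K b v := Nat.one_le_two_pow
      refine h2.trans ?_
      simpa [hv, mass] using h1
    | succ ρ ih =>
      have := hcon ρ (by omega)
      have := ih (by omega)
      rw [pow_succ]
      omega
  exact absurd ((hgrow K le_rfl).trans (mass_le_potential i v K)) (not_le.2 h.potential_lt)

/-- By `hw` the colour `i` is new for `w`, so the exponent grows by exactly one where `P` holds. -/
theorem weight_add_boundary {v w : V} {i : ℕ} {P : V → Prop} (hi : i < K)
    (hw : ∀ u, ¬ b w i u) :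
    weight K (fun w' i' u' => b w' i' u' ∨ (u' = v ∧ i' = i ∧ P w')) w =
      if P w then 2 * weight K b w else weight K b w := by
  split_ifs with hP
  · have : ((Finset.range K).filter fun i' => ∃ u, b w i' u ∨ (u = v ∧ i' = i ∧ P w)) =
        insert i ((Finset.range K).filter fun i' => ∃ u, b w i' u) := by
      ext i'
      simp only [Finset.mem_filter, Finset.mem_range, Finset.mem_insert]
      constructor
      · rintro ⟨h1, u, h | ⟨-, h, -⟩⟩
        · exact Or.inr ⟨h1, u, h⟩
        · exact Or.inl h
      · rintro (rfl | ⟨h1, u, h⟩)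
        · exact ⟨hi, v, Or.inr ⟨rfl, rfl, hP⟩⟩
        · exact ⟨h1, u, Or.inl h⟩
    rw [weight, weight, this, Finset.card_insert_of_notMem (by simp [hw]), pow_succ, mul_comm]
  · simp [weight, hP]

/-- Carving the ball of radius `ρ` around `v` out of the nodes active for the colour `i`. -/
theorem IsCarving.carve [Fintype V] (h : IsCarving G K g b) {v : V} {i ρ : ℕ} (hi : i < K)
    (hρ : ρ < K) (hmass : mass G K g b i v (ρ + 1) ≤ 2 * mass G K g b i v ρ) :
    IsCarving G K
      (fun w i' u => g w i' u ∨ (u = v ∧ i' = i ∧ G.edist v w ≤ ρ ∧ Active g b i w))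
      (fun w i' u => b w i' u ∨ (u = v ∧ i' = i ∧
        (G.edist v w ≤ (ρ + 1 : ℕ) ∧ ¬ G.edist v w ≤ ρ ∧ Active g b i w))) where
  good_near := by
    rintro w i' u (hw | ⟨rfl, rfl, hw, -⟩)
    · exact h.good_near hw
    · exact ⟨hi, edist_le_mono hw hρ.le⟩
  bad_near := by
    rintro w i' u (hw | ⟨rfl, rfl, hw, -⟩)
    · exact h.bad_near hw
    · exact ⟨hi, edist_le_mono hw hρ⟩
  good_unique := by
    rintro w i₁ u₁ i₂ u₂ (h₁ | ⟨rfl, rfl, h₁, h₁'⟩) (h₂ | ⟨rfl, rfl, h₂, h₂'⟩)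
    · exact h.good_unique h₁ h₂
    · exact absurd h₁ (h₂'.1 _ _)
    · exact absurd h₂ (h₁'.1 _ _)
    · exact ⟨rfl, rfl⟩
  closed := by
    rintro w i' u w' (hw | ⟨rfl, rfl, hw, -⟩) hadj
    · rcases h.closed hw hadj with ⟨j, z, hz⟩ | ⟨z, hz⟩
      · exact Or.inl ⟨j, z, Or.inl hz⟩
      · exact Or.inr ⟨z, Or.inl hz⟩
    · by_cases hact : Active g b i' w'
      · by_cases hd : G.edist u w' ≤ ρ
        · exact Or.inl ⟨i', u, Or.inr ⟨rfl, rfl, hd, hact⟩⟩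
        · exact Or.inr ⟨u, Or.inr ⟨rfl, rfl,
            edist_le_add hw (edist_le_one_of_adj hadj), hd, hact⟩⟩
      · rw [Active, not_and_or] at hact
        push Not at hact
        rcases hact with ⟨j, z, hz⟩ | ⟨z, hz⟩
        · exact Or.inl ⟨j, z, Or.inl hz⟩
        · exact Or.inr ⟨z, Or.inl hz⟩
  separated := by
    have key : ∀ {w i' u w'}, g w i' u → Active g b i' w' → ¬ G.Adj w w' := by
      rintro w i' u w' hw hact hadj
      rcases h.closed hw hadj with ⟨j, z, hz⟩ | ⟨z, hz⟩
      · exact hact.1 j z hz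
      · exact hact.2 z hz
    rintro w i' u w' u' (h₁ | ⟨rfl, rfl, h₁, h₁'⟩) (h₂ | ⟨rfl, h₂e, h₂, h₂'⟩) hadj
    · exact h.separated h₁ h₂ hadj
    · subst h₂e
      exact absurd hadj (key h₁ h₂')
    · exact absurd hadj.symm (key h₂ h₁')
    · rfl
  potential_lt := by
    refine lt_of_le_of_lt ?_ h.potential_lt
    -- The identity holds node by node: an active node of weight x gives 0 + 2x = x + x in the ball,
    -- 2x + 0 = x + x on the boundary and x = x beyond. The additive form avoids truncated
    -- subtraction.
    suffices hsum : potential K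
        (fun w i' u => g w i' u ∨ (u = v ∧ i' = i ∧ G.edist v w ≤ ρ ∧ Active g b i w))
        (fun w i' u => b w i' u ∨ (u = v ∧ i' = i ∧
          (G.edist v w ≤ (ρ + 1 : ℕ) ∧ ¬ G.edist v w ≤ ρ ∧ Active g b i w))) +
        2 * mass G K g b i v ρ = potential K g b + mass G K g b i v (ρ + 1) by omega
    simp only [potential, mass, Finset.mul_sum, ← Finset.sum_add_distrib]
    refine Finset.sum_congr rfl fun w _ => ?_
    by_cases hact : Active g b i w
    · rw [weight_add_boundary hi hact.2]
      by_cases h1 : G.edist v w ≤ ρ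
      · have h2 : G.edist v w ≤ (ρ + 1 : ℕ) := edist_le_mono h1 (Nat.le_succ _)
        simp only [hact, h1, h2, hact.1]
        simp
        omega
      · by_cases h2 : G.edist v w ≤ (ρ + 1 : ℕ)
        · simp only [hact, h1, h2, hact.1]
          simp
          omega
        · simp only [hact, h1, h2, hact.1]
          simp
    · simp only [hact, and_false, or_false, if_false, mul_zero, add_zero]
      rw [weight_congr (b' := b) (by tauto)]

end Carving

/-! ### The diameter of monotone walks -/

section Diameter

variable {V : Type*} {G : SimpleGraph V} {K : ℕ} {col : V → ℕ} {cen : V → V}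

/-- Centres are compared along the walk. A step within a colour keeps the centre; a step to a higher
colour moves it by at most K + 1 + K, through the two endpoints of the edge. -/
theorem edist_center_le_of_mem_support (hnear : ∀ v, G.edist (cen v) v ≤ K)
    (hsep : ∀ u v, G.Adj u v → col u = col v → cen u = cen v) {a c : V} (p : G.Walk a c)
    (hp : p.support.Pairwise fun u v => col u ≤ col v) {v : V} (hv : v ∈ p.support) :
    G.edist (cen a) v ≤ (K + (2 * K + 1) * (col v - col a) : ℕ) := by
  induction p with
  | nil =>
    obtain rfl : v = _ := by simpa using hv
    exact edist_le_mono (hnear v) (Nat.le_add_right _ _)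
  | @cons a a' c hadj p ih =>
    rw [Walk.support_cons, List.pairwise_cons] at hp
    rw [Walk.support_cons, List.mem_cons] at hv
    rcases hv with rfl | hv
    · exact edist_le_mono (hnear v) (Nat.le_add_right _ _)
    have ih := ih hp.2 hv
    have h1 : col a ≤ col a' := hp.1 a' p.start_mem_support
    have h2 : col a' ≤ col v := by
      have hp2 := hp.2
      rw [← Walk.cons_tail_support] at hv hp2
      rcases List.mem_cons.1 hv with rfl | hv
      · exact le_rfl
      · exact (List.pairwise_cons.1 hp2).1 v hv
    rcases h1.eq_or_lt with h | h
    · rw [hsep a a' hadj h, h]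
      exact ih
    · have e1 : G.edist a' (cen a') ≤ K := by
        rw [SimpleGraph.edist_comm]
        exact hnear a'
      refine edist_le_mono (edist_le_add (edist_le_add (edist_le_add (hnear a)
        (edist_le_one_of_adj hadj)) e1) ih) ?_
      have : (2 * K + 1) * (col v - col a' + 1) ≤ (2 * K + 1) * (col v - col a) :=
        Nat.mul_le_mul_left _ (by omega)
      rw [mul_add] at this
      omega

/-- From the first node of a walk the distance is at most K to its centre plus K + (2K + 1)(K - 1),
in total below 3K². Other pairs follow by dropping first nodes. -/
theorem edist_le_of_mem_support (hnear : ∀ v, G.edist (cen v) v ≤ K)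
    (hsep : ∀ u v, G.Adj u v → col u = col v → cen u = cen v) (hcol : ∀ v, col v < K)
    {a c : V} (p : G.Walk a c) (hp : p.support.Pairwise fun u v => col u ≤ col v) {u v : V}
    (hu : u ∈ p.support) (hv : v ∈ p.support) : G.edist u v ≤ (3 * K ^ 2 : ℕ) := by
  have hstart : ∀ {a c : V} (p : G.Walk a c) (_ : p.support.Pairwise fun u v => col u ≤ col v)
      {v : V} (_ : v ∈ p.support), G.edist a v ≤ (3 * K ^ 2 : ℕ) := by
    intro a c p hp v hv
    have e1 : G.edist a (cen a) ≤ K := by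
      rw [SimpleGraph.edist_comm]
      exact hnear a
    refine edist_le_mono (edist_le_add e1 (edist_center_le_of_mem_support hnear hsep p hp hv)) ?_
    have hv := hcol v
    obtain ⟨k, rfl⟩ : ∃ k, K = k + 1 := ⟨K - 1, by omega⟩
    have : (2 * (k + 1) + 1) * (col v - col a) ≤ (2 * (k + 1) + 1) * k :=
      Nat.mul_le_mul_left _ (by omega)
    nlinarith
  induction p with
  | nil =>
    obtain rfl : u = _ := by simpa using hu
    exact hstart _ hp hv
  | cons hadj p ih =>
    rcases List.mem_cons.1 (Walk.support_cons hadj p ▸ hu) with rfl | hu'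
    · exact hstart _ hp hv
    · rcases List.mem_cons.1 (Walk.support_cons hadj p ▸ hv) with rfl | hv'
      · rw [SimpleGraph.edist_comm]
        exact hstart _ hp hu
      · rw [Walk.support_cons, List.pairwise_cons] at hp
        exact ih hp.2 hu' hv'

/-- The label is a two-digit number in base `m`: the quotient recovers the colour, so colours are
monotone along increasing paths, and the remainder recovers the identifier. -/
theorem isDiameterOrdering_of_clustering (hnear : ∀ v, G.edist (cen v) v ≤ K)
    (hsep : ∀ u v, G.Adj u v → col u = col v → cen u = cen v) (hcol : ∀ v, col v < K)
    {ident : V → ℕ} (hid : Function.Injective ident) {m : ℕ} (hm : ∀ v, ident v < m) {D : ℝ}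
    (hD : (3 * K ^ 2 : ℕ) ≤ D) :
    IsDiameterOrdering G D fun v => col v * m + ident v := by
  have hdiv : ∀ v, (col v * m + ident v) / m = col v := fun v => by
    rw [mul_comm, Nat.mul_add_div (by have := hm v; omega), Nat.div_eq_of_lt (hm v), add_zero]
  refine ⟨fun u v huv => hid ?_, fun a c p _ hp u hu v hv => ?_⟩
  · have h := congrArg (· % m) huv
    simpa [Nat.mul_add_mod', Nat.mod_eq_of_lt (hm _)] using h
  · have hp' : p.support.Pairwise fun u v => col u ≤ col v := hp.imp fun {u v} h => by
      rw [← hdiv u, ← hdiv v]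
      exact Nat.div_le_div_right h.le
    have := dist_le_of_edist_le (edist_le_of_mem_support hnear hsep hcol p hp' hu hv)
    exact le_trans (by exact_mod_cast this) hD

end Diameter

/-! ### Ball carving in the SLOCAL model -/

/-- The memory of a node: the colour of the cluster which it carves, and the identifiers of the nodes
in this cluster and on its boundary. -/
structure CarveMem where
  color : ℕ
  good : Set ℕ
  bad : Set ℕ

/-- The labels which a node sees while the carving algorithm runs. -/
abbrev CarveLabel := Unit × Option (ℕ × CarveMem)

namespace View

/-- The node `j` is in a cluster of colour `i`. -/
def IsGood (W : View CarveLabel) (j i : ℕ) : Prop :=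
  ∃ p ∈ W.nodes, ∃ o m, p.2.2 = some (o, m) ∧ m.color = i ∧ j ∈ m.good

/-- The node `j` is on the boundary of a cluster of colour `i`. -/
def IsBad (W : View CarveLabel) (j i : ℕ) : Prop :=
  ∃ p ∈ W.nodes, ∃ o m, p.2.2 = some (o, m) ∧ m.color = i ∧ j ∈ m.bad

/-- The nodes active for the colour `i` within distance `ρ` of the centre of the view. -/
def activeBall (W : View CarveLabel) (i ρ : ℕ) : Set ℕ :=
  {j | Within W.edges ρ W.center j ∧ (∀ i', ¬ W.IsGood j i') ∧ ¬ W.IsBad j i}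

open scoped Classical in
/-- The weight of `activeBall`. -/
noncomputable def ballMass (W : View CarveLabel) (K i ρ : ℕ) : ℕ :=
  ∑ᶠ j ∈ W.activeBall i ρ, 2 ^ ((Finset.range K).filter fun i' => W.IsBad j i').card

/-- The centre of the view may carve a cluster of colour `q.1` and radius `q.2`. -/
def CanCarve (W : View CarveLabel) (K : ℕ) (q : ℕ × ℕ) : Prop :=
  q.1 < K ∧ ¬ W.IsBad W.center q.1 ∧ q.2 < K ∧
    W.ballMass K q.1 (q.2 + 1) ≤ 2 * W.ballMass K q.1 q.2

end View

/-- The number of colours, which is also a bound for the radius of the clusters. -/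
def numColors (n : ℕ) : ℕ := Nat.log 2 n + 1

open scoped Classical in
/-- A step of sequential ball carving. A node that is in no cluster yet carves a cluster around itself;
the output of a node is composed of the colour of its cluster and its identifier. -/
noncomputable def carveStep (κ n : ℕ) (W : View CarveLabel) : ℕ × CarveMem :=
  if h : ∃ i, W.IsGood W.center i then
    -- With both sets empty, colour `0` in the memory is a dummy value and records no cluster.
    (h.choose * (n ^ κ + 1) + W.center, ⟨0, ∅, ∅⟩)
  else if h : ∃ q, W.CanCarve (numColors n) q then
    (h.choose.1 * (n ^ κ + 1) + W.center, ⟨h.choose.1, W.activeBall h.choose.1 h.choose.2,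
      W.activeBall h.choose.1 (h.choose.2 + 1) \ W.activeBall h.choose.1 h.choose.2⟩)
  -- Never reached during a run: `CarveInv.step` shows that an unclustered node can always carve.
  else (0, ⟨0, ∅, ∅⟩)

/-- Sequential ball carving. -/
noncomputable def carveAlg (κ : ℕ) : SlocalAlg Unit ℕ where
  Mem := CarveMem
  step := carveStep κ

/-! ### Correctness of the carving algorithm: views against the global clustering. -/

section Run

variable {n : ℕ} {G : SimpleGraph (Fin n)} {ident : Fin n → ℕ}

/-- The clusters recorded in the memories. -/
def goodRel (ident : Fin n → ℕ) (S : Fin n → Option (ℕ × CarveMem)) (w : Fin n) (i : ℕ)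
    (u : Fin n) : Prop :=
  ∃ o m, S u = some (o, m) ∧ m.color = i ∧ ident w ∈ m.good

/-- The boundaries recorded in the memories. -/
def badRel (ident : Fin n → ℕ) (S : Fin n → Option (ℕ × CarveMem)) (w : Fin n) (i : ℕ)
    (u : Fin n) : Prop :=
  ∃ o m, S u = some (o, m) ∧ m.color = i ∧ ident w ∈ m.bad

variable {S : Fin n → Option (ℕ × CarveMem)} {K : ℕ}

/-- The record of a cluster sits in the memory of its centre, at most `K` from `w` and so at most `2
* K` from `v`. This is the source of the locality `2 * K`. -/
theorem isGood_view_iff (hS : IsCarving G K (goodRel ident S) (badRel ident S)) {v w : Fin n}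
    (hw : G.edist v w ≤ K) {i : ℕ} :
    (view G ident (fun u => ((), S u)) (2 * K) v).IsGood (ident w) i ↔
      ∃ u, goodRel ident S w i u := by
  constructor
  · rintro ⟨_, ⟨u, -, rfl⟩, h⟩
    exact ⟨u, h⟩
  · rintro ⟨u, hu⟩
    have h1 : G.edist w u ≤ K := by
      rw [SimpleGraph.edist_comm]
      exact (hS.good_near hu).2
    exact ⟨_, ⟨u, edist_le_mono (edist_le_add hw h1) (by omega), rfl⟩, hu⟩

theorem isBad_view_iff (hS : IsCarving G K (goodRel ident S) (badRel ident S)) {v w : Fin n}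
    (hw : G.edist v w ≤ K) {i : ℕ} :
    (view G ident (fun u => ((), S u)) (2 * K) v).IsBad (ident w) i ↔
      ∃ u, badRel ident S w i u := by
  constructor
  · rintro ⟨_, ⟨u, -, rfl⟩, h⟩
    exact ⟨u, h⟩
  · rintro ⟨u, hu⟩
    have h1 : G.edist w u ≤ K := by
      rw [SimpleGraph.edist_comm]
      exact (hS.bad_near hu).2
    exact ⟨_, ⟨u, edist_le_mono (edist_le_add hw h1) (by omega), rfl⟩, hu⟩

theorem activeBall_view (hid : Function.Injective ident)
    (hS : IsCarving G K (goodRel ident S) (badRel ident S)) (v : Fin n) (i : ℕ) {ρ : ℕ}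
    (hρ : ρ ≤ K) :
    (view G ident (fun u => ((), S u)) (2 * K) v).activeBall i ρ =
      ident '' {w | G.edist v w ≤ ρ ∧ Active (goodRel ident S) (badRel ident S) i w} := by
  have hv : G.edist v v ≤ (0 : ℕ) := by simp
  have hact : ∀ w, G.edist v w ≤ ρ →
      (((∀ i', ¬ (view G ident (fun u => ((), S u)) (2 * K) v).IsGood (ident w) i') ∧
        ¬ (view G ident (fun u => ((), S u)) (2 * K) v).IsBad (ident w) i) ↔
      Active (goodRel ident S) (badRel ident S) i w) := by
    intro w hw
    have hw := edist_le_mono hw hρ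
    simp only [isGood_view_iff hS hw, isBad_view_iff hS hw, Active, not_exists]
  ext j
  constructor
  · rintro ⟨h1, h2⟩
    obtain ⟨w, hw, rfl⟩ := (within_view_iff hid (by omega) hv).1 h1
    exact ⟨w, ⟨hw, (hact w hw).1 h2⟩, rfl⟩
  · rintro ⟨w, ⟨hw, h2⟩, rfl⟩
    exact ⟨(within_view_iff hid (by omega) hv).2 ⟨w, hw, rfl⟩, (hact w hw).2 h2⟩

theorem ballMass_view (hid : Function.Injective ident)
    (hS : IsCarving G K (goodRel ident S) (badRel ident S)) (v : Fin n) (i : ℕ) {ρ : ℕ}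
    (hρ : ρ ≤ K) :
    (view G ident (fun u => ((), S u)) (2 * K) v).ballMass K i ρ =
      mass G K (goodRel ident S) (badRel ident S) i v ρ := by
  classical
  rw [View.ballMass, activeBall_view hid hS v i hρ, finsum_mem_image hid.injOn,
    finsum_mem_eq_toFinset_sum, mass, ← Finset.sum_filter]
  refine Finset.sum_congr (by ext w; simp) fun w hw => ?_
  have hw : G.edist v w ≤ K := edist_le_mono (Finset.mem_filter.1 hw).2.1 hρ
  simp only [isBad_view_iff hS hw, weight]
  congr!

theorem canCarve_view_iff (hid : Function.Injective ident)
    (hS : IsCarving G K (goodRel ident S) (badRel ident S)) (v : Fin n) (i ρ : ℕ) :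
    (view G ident (fun u => ((), S u)) (2 * K) v).CanCarve K (i, ρ) ↔
      i < K ∧ (∀ u, ¬ badRel ident S v i u) ∧ ρ < K ∧
        mass G K (goodRel ident S) (badRel ident S) i v (ρ + 1) ≤
          2 * mass G K (goodRel ident S) (badRel ident S) i v ρ := by
  have hv : G.edist v v ≤ K := by simp
  have hbad := isBad_view_iff hS hv (i := i)
  rw [View.CanCarve]
  change (i < K ∧ ¬ (view G ident (fun u => ((), S u)) (2 * K) v).IsBad (ident v) i ∧ ρ < K ∧ _) ↔ _
  rw [hbad, not_exists]
  refine and_congr_right fun _ => and_congr_right fun _ => and_congr_right fun hρ => ?_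
  rw [ballMass_view hid hS v i hρ, ballMass_view hid hS v i hρ.le]

/-- The states reached by the carving algorithm: the memories describe a partial clustering, and every
processed node is in a cluster, whose colour it has output. -/
structure CarveInv (κ : ℕ) (G : SimpleGraph (Fin n)) (ident : Fin n → ℕ)
    (S : Fin n → Option (ℕ × CarveMem)) : Prop where
  carving : IsCarving G (numColors n) (goodRel ident S) (badRel ident S)
  output : ∀ {u o m}, S u = some (o, m) →
    ∃ i c, goodRel ident S u i c ∧ o = i * (n ^ κ + 1) + ident u

/-- Since `v` had no record before, writing its memory only adds to the relation, in the form that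
`IsCarving.carve` produces. -/
theorem goodRel_update {v : Fin n} (hv : S v = none) (o : ℕ) (m : CarveMem) :
    goodRel ident (Function.update S v (some (o, m))) = fun w i u =>
      goodRel ident S w i u ∨ (u = v ∧ i = m.color ∧ ident w ∈ m.good) := by
  funext w i u
  refine propext ?_
  by_cases hu : u = v
  · subst hu
    simp [goodRel, hv, eq_comm]
  · simp [goodRel, hu]

theorem badRel_update {v : Fin n} (hv : S v = none) (o : ℕ) (m : CarveMem) :
    badRel ident (Function.update S v (some (o, m))) = fun w i u =>
      badRel ident S w i u ∨ (u = v ∧ i = m.color ∧ ident w ∈ m.bad) := by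
  funext w i u
  refine propext ?_
  by_cases hu : u = v
  · subst hu
    simp [badRel, hv, eq_comm]
  · simp [badRel, hu]

theorem CarveInv.update {κ : ℕ} (hS : CarveInv κ G ident S) {v : Fin n} (hv : S v = none) {o : ℕ}
    {m : CarveMem}
    (hcarve : IsCarving G (numColors n)
      (fun w i u => goodRel ident S w i u ∨ (u = v ∧ i = m.color ∧ ident w ∈ m.good))
      (fun w i u => badRel ident S w i u ∨ (u = v ∧ i = m.color ∧ ident w ∈ m.bad)))
    (hout : ∃ i c, (goodRel ident S v i c ∨ (c = v ∧ i = m.color ∧ ident v ∈ m.good)) ∧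
      o = i * (n ^ κ + 1) + ident v) :
    CarveInv κ G ident (Function.update S v (some (o, m))) where
  carving := by rwa [goodRel_update hv, badRel_update hv]
  output := by
    intro u o' m' hu
    rw [goodRel_update hv]
    by_cases huv : u = v
    · subst huv
      rw [Function.update_self, Option.some.injEq, Prod.mk.injEq] at hu
      rwa [← hu.1]
    · rw [Function.update_of_ne huv] at hu
      obtain ⟨i, c, h1, h2⟩ := hS.output hu
      exact ⟨i, c, Or.inl h1, h2⟩

/-- The node either lies in a recorded cluster already or carves one containing itself. In the
second case the sets it computes from its view are those of `IsCarving.carve`. -/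
theorem CarveInv.step {κ : ℕ} (hid : Function.Injective ident) (hS : CarveInv κ G ident S)
    {v : Fin n} (hv : S v = none) :
    CarveInv κ G ident (Function.update S v (some (carveStep κ n
      (view G ident (fun u => ((), S u)) (2 * numColors n) v)))) := by
  classical
  have hvK : G.edist v v ≤ numColors n := by simp
  set W := view G ident (fun u => ((), S u)) (2 * numColors n) v with hW
  have hc : W.center = ident v := rfl
  by_cases h : ∃ i, W.IsGood W.center i
  · have hstep : carveStep κ n W =
      (h.choose * (n ^ κ + 1) + ident v, (⟨0, ∅, ∅⟩ : CarveMem)) := dif_pos h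
    rw [hstep]
    refine hS.update hv (by simpa using hS.carving) ?_
    obtain ⟨u, hu⟩ := (isGood_view_iff hS.carving hvK).1 h.choose_spec
    exact ⟨h.choose, u, Or.inl hu, rfl⟩
  · have hng : ∀ j u, ¬ goodRel ident S v j u := fun j u hu =>
      h ⟨j, (isGood_view_iff hS.carving hvK).2 ⟨u, hu⟩⟩
    have hex : ∃ q, W.CanCarve (numColors n) q := by
      obtain ⟨i, hi, hb⟩ := hS.carving.exists_active hng
      obtain ⟨ρ, hρ, hm⟩ := hS.carving.exists_radius (i := i) ⟨hng, hb⟩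
      exact ⟨(i, ρ), (canCarve_view_iff hid hS.carving v i ρ).2 ⟨hi, hb, hρ, hm⟩⟩
    have hstep : carveStep κ n W = (hex.choose.1 * (n ^ κ + 1) + ident v,
        (⟨hex.choose.1, W.activeBall hex.choose.1 hex.choose.2,
          W.activeBall hex.choose.1 (hex.choose.2 + 1) \
            W.activeBall hex.choose.1 hex.choose.2⟩ : CarveMem)) :=
      (dif_neg h).trans (dif_pos hex)
    rw [hstep]
    generalize hq : hex.choose = q
    have hspec : W.CanCarve (numColors n) q := hq ▸ hex.choose_spec
    obtain ⟨i, ρ⟩ := q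
    obtain ⟨hi, hb, hρ, hm⟩ := (canCarve_view_iff hid hS.carving v i ρ).1 hspec
    have hgood : ∀ w, ident w ∈ W.activeBall i ρ ↔
        G.edist v w ≤ ρ ∧ Active (goodRel ident S) (badRel ident S) i w := fun w => by
      rw [hW, activeBall_view hid hS.carving v i hρ.le, hid.mem_set_image]
      rfl
    have hbad : ∀ w, ident w ∈ W.activeBall i (ρ + 1) \ W.activeBall i ρ ↔
        G.edist v w ≤ (ρ + 1 : ℕ) ∧ ¬ G.edist v w ≤ ρ ∧
          Active (goodRel ident S) (badRel ident S) i w := fun w => by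
      rw [Set.mem_sdiff, hgood, hW, activeBall_view hid hS.carving v i hρ, hid.mem_set_image,
        Set.mem_ofPred_eq]
      tauto
    refine hS.update hv ?_ ⟨i, v, Or.inr ⟨rfl, rfl, (hgood v).2 ⟨by simp, hng, hb⟩⟩, rfl⟩
    simp only [hgood, hbad]
    exact hS.carving.carve hi hρ hm

theorem carveInv_none (κ : ℕ) : CarveInv κ G ident fun _ => none where
  carving := by
    -- All weights are initially 1, so the potential is `n`; this dictates the number of colours.
    have h : Fintype.card (Fin n) < 2 ^ numColors n := by
      rw [Fintype.card_fin]
      exact Nat.lt_pow_succ_log_self (by norm_num) n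
    have hg : goodRel ident (fun _ => none) = fun _ _ _ => False := by
      funext w i u
      simp [goodRel]
    have hb : badRel ident (fun _ => none) = fun _ _ _ => False := by
      funext w i u
      simp [badRel]
    rw [hg, hb]
    exact isCarving_empty h
  output h := by simp at h

theorem carveInv_run {κ : ℕ} (hid : Function.Injective ident) (l : List (Fin n))
    (hl : l.Nodup) :
    CarveInv κ G ident ((carveAlg κ).run G ident (fun _ => ()) (2 * numColors n) l) ∧
      ∀ v, (carveAlg κ).run G ident (fun _ => ()) (2 * numColors n) l v = none ↔ v ∉ l := by
  induction l using List.reverseRecOn with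
  | nil => exact ⟨carveInv_none κ, fun v => by simp [SlocalAlg.run]⟩
  | append_singleton l w ih =>
    rw [List.nodup_append] at hl
    obtain ⟨ih1, ih2⟩ := ih hl.1
    have hw : w ∉ l := fun h => hl.2.2 w h w (by simp) rfl
    rw [SlocalAlg.run_concat]
    refine ⟨ih1.step hid ((ih2 w).2 hw), fun v => ?_⟩
    by_cases hvw : v = w
    · subst hvw
      simp
    · rw [Function.update_of_ne hvw, ih2 v]
      simp [hvw]

end Run

/-- Since ln 2 ≥ 1/2, both log₂ n ≤ 2 ln n and 1 ≤ 2 ln n hold for n ≥ 2, so there are at most 4 ln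
n colours, and 48 = 3 · 4². At n = 1 the right side vanishes and the bound fails. -/
theorem three_mul_numColors_sq_le {n : ℕ} (hn : 2 ≤ n) :
    ((3 * numColors n ^ 2 : ℕ) : ℝ) ≤ 48 * Real.log n ^ 2 := by
  have h1 : ((2 : ℝ) ^ Nat.log 2 n) ≤ n := by
    exact_mod_cast Nat.pow_log_le_self 2 (by omega)
  have h2 := Real.log_le_log (by positivity) h1
  rw [Real.log_pow] at h2
  have h3 : Real.log 2 ≤ Real.log n := Real.log_le_log (by norm_num) (by exact_mod_cast hn)
  have h4 : (1 / 2 : ℝ) ≤ Real.log 2 := by linarith [Real.log_two_gt_d9]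
  have h0 : (0 : ℝ) ≤ Nat.log 2 n := Nat.cast_nonneg _
  have h5 : ((Nat.log 2 n : ℝ) + 1) ≤ 4 * Real.log n := by nlinarith
  have h6 := pow_le_pow_left₀ (by positivity) h5 2
  simp only [numColors]
  push_cast
  nlinarith

theorem isPolylog_numColors : IsPolylog fun n => (2 * numColors n : ℕ) := by
  refine ⟨1, IsBigO.of_bound 8 ?_⟩
  filter_upwards [eventually_ge_atTop 2] with n hn
  have h := three_mul_numColors_sq_le hn
  have h0 : 0 ≤ Real.log n := Real.log_natCast_nonneg n
  push_cast at h ⊢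
  rw [Real.norm_of_nonneg (by positivity), Real.norm_of_nonneg (by positivity), pow_one]
  have : (numColors n : ℝ) ≤ 4 * Real.log n := abs_le_of_sq_le_sq' (by nlinarith) (by positivity) |>.2
  linarith

/-- Diameter orderings can be computed in the SLOCAL model. -/
theorem inPSLOCAL_orderingProblem (κ : ℕ) {d : ℕ → ℝ}
    (hd : ∀ n : ℕ, 1 ≤ n → 48 * Real.log n ^ 2 ≤ d n) : InPSLOCAL κ (orderingProblem d) := by
  refine ⟨fun n => 2 * numColors n, isPolylog_numColors, carveAlg κ,
    fun n G ident x order hid hnd hmem => ?_⟩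
  obtain ⟨hinv, hnone⟩ := carveInv_run (G := G) (κ := κ) hid.1 order hnd
  have hrun : ∀ v, ∃ q : ℕ × CarveMem,
      (carveAlg κ).run G ident (fun _ => ()) (2 * numColors n) order v = some q := fun v =>
    Option.ne_none_iff_exists'.1 fun h => (hnone v).1 h (hmem v)
  choose q hq using hrun
  choose col cen hgood hout using fun v => hinv.output (hq v)
  refine ⟨fun v => (q v).1, ?_, fun v => ⟨(q v).2, hq v⟩⟩
  change IsDiameterOrdering G (d n) fun v => (q v).1
  simp only [hout]
  by_cases hn : 2 ≤ n
  · refine isDiameterOrdering_of_clustering (K := numColors n) (cen := cen)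
      (fun v => (hinv.carving.good_near (hgood v)).2)
      (fun u v hadj h => hinv.carving.separated (hgood u) (h ▸ hgood v) hadj)
      (fun v => (hinv.carving.good_near (hgood v)).1) hid.1
      (fun v => Nat.lt_succ_of_le (hid.2 v).2)
      ((three_mul_numColors_sq_le hn).trans (hd n (by omega)))
  -- With at most one node all distances are 0, and only `0 ≤ d n` is needed; the existing node `a`
  -- gives `1 ≤ n`.
  · have : Subsingleton (Fin n) := Fin.subsingleton_iff_le_one.2 (by omega)
    refine ⟨fun u v _ => Subsingleton.elim u v, fun a _ _ _ _ u _ v _ => ?_⟩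
    rw [Subsingleton.elim u v, SimpleGraph.dist_self, Nat.cast_zero]
    exact le_trans (by positivity) (hd n (by have := a.pos; omega))

/-! ### Existence of diameter orderings -/

theorem edist_hom_le {V V' : Type*} {G : SimpleGraph V} {G' : SimpleGraph V'} (f : G →g G')
    (u v : V) : G'.edist (f u) (f v) ≤ G.edist u v :=
  le_iInf fun p => (edist_le (p.map f)).trans_eq (by rw [Walk.length_map])

theorem dist_iso {V V' : Type*} {G : SimpleGraph V} {G' : SimpleGraph V'} (φ : G ≃g G')
    (u v : V) : G'.dist (φ u) (φ v) = G.dist u v := by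
  refine congrArg ENat.toNat (le_antisymm (edist_hom_le φ.toHom u v) ?_)
  have h : G.edist (φ.symm (φ u)) (φ.symm (φ v)) ≤ G'.edist (φ u) (φ v) :=
    edist_hom_le φ.symm.toHom (φ u) (φ v)
  rwa [φ.symm_apply_apply, φ.symm_apply_apply] at h

theorem IsDiameterOrdering.comp_iso {V V' : Type*} {G : SimpleGraph V} {G' : SimpleGraph V'}
    (φ : G ≃g G') {D : ℝ} {label : V' → ℕ} (h : IsDiameterOrdering G' D label) :
    IsDiameterOrdering G D (label ∘ φ) := by
  refine ⟨h.1.comp φ.injective, fun a b p hp hinc u hu v hv => ?_⟩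
  rw [← dist_iso φ]
  refine h.2 _ _ (p.map φ.toHom) (Walk.IsPath.map φ.injective hp) ?_ _ ?_ _ ?_
  · rw [Walk.support_map, List.pairwise_map]
    exact hinc
  · rw [Walk.support_map]
    exact List.mem_map_of_mem hu
  · rw [Walk.support_map]
    exact List.mem_map_of_mem hv

/-- The SLOCAL algorithm, run on a copy of `G` on `Fin n` with identifiers 1, …, n, constructs the
ordering, which is then transported back. -/
theorem exists_isDiameterOrdering {V : Type*} [Fintype V] (G : SimpleGraph V) :
    ∃ label : V → ℕ, IsDiameterOrdering G (48 * Real.log (Fintype.card V) ^ 2) label := by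
  obtain ⟨t, -, A, hA⟩ := inPSLOCAL_orderingProblem 1
    (d := fun n => 48 * Real.log n ^ 2) fun _ _ => le_rfl
  have hid : IsIdAssignment 1 fun v : Fin (Fintype.card V) => (v : ℕ) + 1 :=
    ⟨fun u v h => Fin.ext (Nat.succ_injective h), fun v => by simp⟩
  obtain ⟨y, hy, -⟩ := hA _ (G.map (Fintype.equivFin V).toEmbedding) _ (fun _ => ()) _ hid
    (List.nodup_finRange _) List.mem_finRange
  exact ⟨_, IsDiameterOrdering.comp_iso (SimpleGraph.Iso.map (Fintype.equivFin V) G) hy⟩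

end Distributed

theorem mainTheorem5 :
    ∃ c : ℝ, 0 < c ∧
      (∀ (κ : ℕ) (d : ℕ → ℝ), 1 ≤ κ →
        (∀ n : ℕ, 1 ≤ n → c * Real.log n ^ 2 ≤ d n) → Distributed.IsPolylog d →
          Distributed.IsPSLOCALComplete κ (Distributed.orderingProblem d)) ∧
      (∀ (V : Type*) [Fintype V] (G : SimpleGraph V),
        ∃ label : V → ℕ,
          Distributed.IsDiameterOrdering G (c * Real.log (Fintype.card V) ^ 2) label) :=
  ⟨48, by norm_num, fun κ _ _ hd hpoly => ⟨Distributed.inPSLOCAL_orderingProblem κ hd,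
    fun _ hQ => Distributed.polylogReducible_orderingProblem hpoly hQ⟩,
    fun _ _ G => Distributed.exists_isDiameterOrdering G⟩
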